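/- Let $\mathcal F$ be a signature (a set of function symbols, each with a fixed arity) and $\mathcal V$ a countably infinite set of variables. Let a sort attachment with set of sorts $S$ be given, that is, a type $f:\alpha_1\times\cdots\times\alpha_n\to\alpha$ with $\alpha_i,\alpha\in S$ for each $n$-ary $f\in\mathcal F$, and a sort in $S$ for each variable, such that for each $\alpha\in S$ the set $\mathcal V_\alpha$ of variables of sort $\alpha$ is countably infinite. Let the sets $\mathcal T_\alpha$ of terms of sort $\alpha$ be defined inductively by $$\mathcal T_\alpha=\mathcal V_\alpha\cup\{f(t_1,\dots,t_n)\mid f:\alpha_1\times\cdots\times\alpha_n\to\alpha \text{ and } t_i\in\mathcal T_{\alpha_i}\text{ for } 1\le i\le n\},$$ and let $\mathcal T_{\mathrm{ms}}=\bigcup_{\alpha\in S}\mathcal T_\alpha$ be the set of many-sorted terms. Let $\mathcal R$ be a term rewrite system over $\mathcal F$ and $\mathcal V$, that is, a set of rules $\ell\to r$ between terms such that $\ell$ is not a variable and every variable of $r$ occurs in $\ell$; let $\to_{\mathcal R}$ be its rewrite relation on the set of all (unsorted) terms $\mathcal T(\mathcal F,\mathcal V)$. A relation $\to$ is confluent if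 $t\mathrel{{}^*\!\leftarrow} s\to^* u$ always implies $t\to^* v\mathrel{{}^*\!\leftarrow} u$ for some $v$; it is confluent on a set $T$ if $T$ is closed under $\to$ and ${\to}\cap(T\times T)$ is confluent. **Theorem.** Suppose that $\mathcal R$ is compatible with the sort attachment, i.e. for each rule $\ell\to r\in\mathcal R$ there is $\alpha\in S$ with $\ell,r\in\mathcal T_\alpha$. If $\to_{\mathcal R}$ is confluent on $\mathcal T_{\mathrm{ms}}$, then $\to_{\mathcal R}$ is confluent on the set of all terms $\mathcal T(\mathcal F,\mathcal V)$. -/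

import Mathlib

universe u v w z

namespace TermRewriting

/- A signature (function symbols with fixed arities) is the family of function symbols of a
first-order language `L`; relation symbols of `L` do not occur in terms and play no role.
The terms over the signature and the variables `V` are `L.Term V`, and the homomorphic
extension of a substitution `σ : V → L.Term V` to terms is `fun t => t.subst σ`. -/

/-- A term rewrite system: a set of rules `(ℓ, r)` such that `ℓ` is not a variable and every
variable of `r` occurs in `ℓ`. -/
structure TRS (L : FirstOrder.Language.{u, v}) (V : Type w) where
  rules : Set (L.Term V × L.Term V)
  lhs_not_var : ∀ ℓ r, (ℓ, r) ∈ rules → ∀ x : V, ℓ ≠ FirstOrder.Language.Term.var x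
  vars_subset : open Classical in ∀ ℓ r, (ℓ, r) ∈ rules → r.varFinset ⊆ ℓ.varFinset

/-- The rewrite relation of a term rewrite system: contract one instance of a left-hand side
at the root or inside one argument. -/
inductive TRS.Step {L : FirstOrder.Language.{u, v}} {V : Type w} (R : TRS L V) :
    L.Term V → L.Term V → Prop
  | root (ℓ r : L.Term V) (h : (ℓ, r) ∈ R.rules) (σ : V → L.Term V) :
      TRS.Step R (ℓ.subst σ) (r.subst σ)
  | arg {n : ℕ} (f : L.Functions n) (ts : Fin n → L.Term V) (i : Fin n) (t : L.Term V)
      (h : TRS.Step R (ts i) t) :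
      TRS.Step R (FirstOrder.Language.Term.func f ts) (FirstOrder.Language.Term.func f (Function.update ts i t))

/-- Confluence of a binary relation: any two reducts of a common element are joinable. -/
def Confluent {α : Type*} (r : α → α → Prop) : Prop :=
  ∀ s t u, Relation.ReflTransGen r s t → Relation.ReflTransGen r s u →
    ∃ v, Relation.ReflTransGen r t v ∧ Relation.ReflTransGen r u v

/-- `r` is confluent on `T` if `T` is closed under `r` and the restriction of `r` to `T × T`
is confluent. -/
def ConfluentOn {α : Type*} (r : α → α → Prop) (T : Set α) : Prop :=
  (∀ s ∈ T, ∀ t, r s t → t ∈ T) ∧ Confluent (fun s t => s ∈ T ∧ t ∈ T ∧ r s t)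

/-- A many-sorted sort attachment with sorts `S`: every `n`-ary function symbol `f` gets a type
`argSort f 0 × ⋯ × argSort f (n - 1) → resSort f` and every variable gets a sort, such that
there are countably infinitely many variables of each sort. -/
structure SortAttachment (L : FirstOrder.Language.{u, v}) (V : Type w) (S : Type z) where
  argSort : ∀ {n : ℕ}, L.Functions n → Fin n → S
  resSort : ∀ {n : ℕ}, L.Functions n → S
  varSort : V → S
  vars_countable : ∀ α : S, {x : V | varSort x = α}.Countable
  vars_infinite : ∀ α : S, {x : V | varSort x = α}.Infinite

/-- `A.HasSort t α`: the term `t` is well-sorted, of sort `α`. -/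
inductive SortAttachment.HasSort {L : FirstOrder.Language.{u, v}} {V : Type w} {S : Type z}
    (A : SortAttachment L V S) : L.Term V → S → Prop
  | var (x : V) : SortAttachment.HasSort A (FirstOrder.Language.Term.var x) (A.varSort x)
  | func {n : ℕ} (f : L.Functions n) (ts : Fin n → L.Term V)
      (h : ∀ i, SortAttachment.HasSort A (ts i) (A.argSort f i)) :
      SortAttachment.HasSort A (FirstOrder.Language.Term.func f ts) (A.resSort f)

/-- The set of many-sorted terms: the union over all sorts `α` of the terms of sort `α`. -/
def SortAttachment.sortedTerms {L : FirstOrder.Language.{u, v}} {V : Type w} {S : Type z}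
    (A : SortAttachment L V S) : Set (L.Term V) :=
  {t | ∃ α : S, A.HasSort t α}

/-- `R` is compatible with `A` if both sides of each rule have a common sort. -/
def TRS.Compatible {L : FirstOrder.Language.{u, v}} {V : Type w} {S : Type z}
    (R : TRS L V) (A : SortAttachment L V S) : Prop :=
  ∀ ℓ r, (ℓ, r) ∈ R.rules → ∃ α : S, A.HasSort ℓ α ∧ A.HasSort r α

end TermRewriting

/-! The proof is by induction on the number of layers. Cut a term into the sorted cap at its top and
the aliens below; these have smaller rank, hence are confluent. Suppose first that no alien can
reduce to a term whose root sort is that of its slot. Then cap and aliens evolve independently.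
Naming the aliens by variables, one for each sort and joinability class, turns the cap into a
many-sorted term, and each step is a step of that term or internal to an alien
(`Separated.simulate_step`). Confluence of sorted terms joins the caps, and confluence of the aliens
joins the fillings (`Cap.confluentAt`). Using classes keeps the names invariant under reduction;
since a name depends only on the alien and its slot sort, non-left-linear rules do no harm. In
general an alien may fuse with the cap. Fusion lowers the rank, so aliens can be reduced beforehand
until they are stable (`exists_reduct_cap`). `mapAliens` does this uniformly: each term reduces to
its image, the images are confluent, and a step becomes a joinable pair of images. Confluence
therefore pulls back (`confluentAt_of_rank`). -/

namespace TermRewriting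

open FirstOrder.Language Relation

/-! ### Joinability among confluent elements -/

section Joinability

variable {α : Type*} {r : α → α → Prop}

/-- Two elements with a common reduct. -/
def Joinable (r : α → α → Prop) (a b : α) : Prop :=
  ∃ c, ReflTransGen r a c ∧ ReflTransGen r b c

/-- Any two reducts of `a` are joinable. -/
def ConfluentAt (r : α → α → Prop) (a : α) : Prop :=
  ∀ b c, ReflTransGen r a b → ReflTransGen r a c → Joinable r b c

theorem Joinable.refl (a : α) : Joinable r a a := ⟨a, .refl, .refl⟩

theorem Joinable.symm {a b : α} (h : Joinable r a b) : Joinable r b a :=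
  let ⟨c, h₁, h₂⟩ := h; ⟨c, h₂, h₁⟩

theorem ConfluentAt.joinable_trans {a b c : α} (hb : ConfluentAt r b)
    (hab : Joinable r a b) (hbc : Joinable r b c) : Joinable r a c := by
  obtain ⟨d, had, hbd⟩ := hab
  obtain ⟨e, hbe, hce⟩ := hbc
  obtain ⟨v, hdv, hev⟩ := hb d e hbd hbe
  exact ⟨v, had.trans hdv, hce.trans hev⟩

theorem ConfluentAt.of_reduct {a b : α} (ha : ConfluentAt r a) (h : ReflTransGen r a b) :
    ConfluentAt r b :=
  fun c d hc hd => ha c d (h.trans hc) (h.trans hd)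

/-- A finite set of pairwise joinable, confluent elements has a common reduct. -/
theorem exists_common_reduct [Nonempty α] {F : Set α} (hF : F.Finite)
    (hconf : ∀ a ∈ F, ConfluentAt r a) (hjoin : ∀ a ∈ F, ∀ b ∈ F, Joinable r a b) :
    ∃ w, ∀ a ∈ F, ReflTransGen r a w := by
  induction F, hF using Set.Finite.induction_on with
  | empty => exact ⟨Classical.arbitrary α, by simp⟩
  | @insert a F _ _ ih =>
    obtain ⟨w, hw⟩ := ih (fun b hb => hconf b (.inr hb))
      (fun b hb c hc => hjoin b (.inr hb) c (.inr hc))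
    rcases F.eq_empty_or_nonempty with rfl | ⟨b, hb⟩
    · exact ⟨a, by rintro c (rfl | h); exacts [.refl, absurd h (by simp)]⟩
    · obtain ⟨v, hav, hwv⟩ := (hconf b (.inr hb)).joinable_trans
        (hjoin a (.inl rfl) b (.inr hb)) ⟨w, hw b hb, .refl⟩
      exact ⟨v, by rintro c (rfl | h); exacts [hav, (hw c h).trans hwv]⟩

/-- Joinability classes of the confluent elements of a countable set can be numbered. -/
theorem exists_class_index {F : Set α} (hF : F.Countable) :
    ∃ e : α → ℕ, ∀ a ∈ F, ∀ b ∈ F, ConfluentAt r a → ConfluentAt r b →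
      (e a = e b ↔ Joinable r a b) := by
  obtain ⟨g, hg⟩ := Set.countable_iff_exists_injOn.1 hF
  -- A class is numbered by the least code of its confluent members in `F`.
  let N : α → Set ℕ := fun a => {k | ∃ c ∈ F, ConfluentAt r c ∧ Joinable r a c ∧ g c = k}
  refine ⟨fun a => sInf (N a), fun a ha b hb hca hcb => ⟨fun h => ?_, fun h => ?_⟩⟩
  · obtain ⟨c, hc, hcc, hac, hgc⟩ : sInf (N a) ∈ N a :=
      Nat.sInf_mem ⟨g a, a, ha, hca, .refl a, rfl⟩
    obtain ⟨d, hd, _, hbd, hgd⟩ : sInf (N b) ∈ N b :=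
      Nat.sInf_mem ⟨g b, b, hb, hcb, .refl b, rfl⟩
    obtain rfl : c = d := hg hc hd (by rw [hgc, hgd]; exact h)
    exact hcc.joinable_trans hac hbd.symm
  · have : N a = N b := by
      ext k
      constructor
      · rintro ⟨c, hc, hcc, hac, hk⟩
        exact ⟨c, hc, hcc, hca.joinable_trans h.symm hac, hk⟩
      · rintro ⟨c, hc, hcc, hbc, hk⟩
        exact ⟨c, hc, hcc, hcb.joinable_trans h hbc, hk⟩
    simp only [this]

end Joinability

variable {L : FirstOrder.Language.{u, v}} {V : Type w} {S : Type z}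

theorem subst_comp (t : L.Term V) (σ τ : V → L.Term V) :
    (t.subst σ).subst τ = t.subst (fun x => (σ x).subst τ) := by
  induction t with
  | var x => rfl
  | func f ts ih => simp only [Term.subst]; congr 1; funext i; exact ih i

/-! ### Closure of rewriting under substitutions and contexts -/

namespace TRS

variable (R : TRS L V)

theorem Step.subst {R : TRS L V} {s t : L.Term V} (h : R.Step s t) (τ : V → L.Term V) :
    R.Step (s.subst τ) (t.subst τ) := by
  induction h with
  | root ℓ r h σ => rw [subst_comp, subst_comp]; exact .root ℓ r h _
  | arg f ts i t _ ih =>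
    have := Step.arg f (fun j => (ts j).subst τ) i _ ih
    refine cast (congrArg _ (congrArg (Term.func f) ?_)) this
    funext j
    by_cases hj : j = i
    · subst hj; simp
    · simp [hj]

theorem not_step_var (x : V) (t : L.Term V) : ¬ R.Step (.var x) t := by
  intro h
  generalize hs : (Term.var x : L.Term V) = s at h
  cases h with
  | root ℓ r h σ =>
    cases ℓ with
    | var y => exact R.lhs_not_var _ _ h y rfl
    | func f ts => simp [Term.subst] at hs
  | arg f ts i t h => simp at hs

theorem reduces_update {n : ℕ} (f : L.Functions n) (ts : Fin n → L.Term V) (i : Fin n)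
    {t : L.Term V} (h : ReflTransGen R.Step (ts i) t) :
    ReflTransGen R.Step (.func f ts) (.func f (Function.update ts i t)) := by
  induction h with
  | refl => rw [Function.update_eq_self]
  | @tail b c _ hbc ih =>
    refine ih.tail ?_
    have := Step.arg (R := R) f (Function.update ts i b) i c (by simpa using hbc)
    simpa using this

theorem reduces_func {n : ℕ} (f : L.Functions n) {ts us : Fin n → L.Term V}
    (h : ∀ i, ReflTransGen R.Step (ts i) (us i)) :
    ReflTransGen R.Step (.func f ts) (.func f us) := by
  have key : ∀ I : Finset (Fin n),
      ReflTransGen R.Step (.func f ts) (.func f (fun i => if i ∈ I then us i else ts i)) := by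
    intro I
    induction I using Finset.induction_on with
    | empty => simpa using ReflTransGen.refl
    | insert a I ha ih =>
      refine ih.trans ?_
      have := R.reduces_update f (fun i => if i ∈ I then us i else ts i) a (t := us a)
        (by simpa [ha] using h a)
      convert this using 2
      funext j
      by_cases hj : j = a
      · subst hj; simp
      · simp [hj]
  simpa using key Finset.univ

theorem joinable_func {n : ℕ} (f : L.Functions n) {ts us : Fin n → L.Term V}
    (h : ∀ i, Joinable R.Step (ts i) (us i)) :
    Joinable R.Step (.func f ts) (.func f us) := by
  choose vs h₁ h₂ using h
  exact ⟨.func f vs, R.reduces_func f h₁, R.reduces_func f h₂⟩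

end TRS

/-! ### Filling variables independently at each occurrence -/

/-- `Inst K M s`: the term `s` arises from `M` by replacing each occurrence of a variable `x`
by some term in `K x`, possibly different ones for different occurrences. -/
inductive Inst (K : V → L.Term V → Prop) : L.Term V → L.Term V → Prop
  | var (x : V) (s : L.Term V) (h : K x s) : Inst K (.var x) s
  | func {n : ℕ} (f : L.Functions n) (Ms ts : Fin n → L.Term V)
      (h : ∀ i, Inst K (Ms i) (ts i)) : Inst K (.func f Ms) (.func f ts)

namespace Inst

variable {K : V → L.Term V → Prop}

open Classical in
theorem subst (p : L.Term V) (τ σ : V → L.Term V)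
    (h : ∀ y ∈ p.varFinset, Inst K (τ y) (σ y)) : Inst K (p.subst τ) (p.subst σ) := by
  induction p with
  | var x => exact h x (by simp [Term.varFinset])
  | func f ts ih =>
    refine .func f _ _ fun i => ih i fun y hy => h y ?_
    simp only [Term.varFinset, Finset.mem_biUnion]
    exact ⟨i, Finset.mem_univ i, hy⟩

/-- Only finitely many fillings occur, so a common reduct can later be chosen for each variable. -/
theorem exists_finite {M s : L.Term V} (h : Inst K M s) :
    ∃ F : Set (L.Term V), F.Finite ∧
      ∀ K' : V → L.Term V → Prop, (∀ x, ∀ a ∈ F, K x a → K' x a) → Inst K' M s := by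
  induction h with
  | var x s h => exact ⟨{s}, Set.finite_singleton s, fun K' hK => .var x s (hK x s rfl h)⟩
  | func f Ms ts _ ih =>
    choose F hF hK using ih
    exact ⟨⋃ i, F i, Set.finite_iUnion hF, fun K' hK' => .func f _ _ fun i =>
      hK i K' fun x a ha => hK' x a (Set.mem_iUnion.2 ⟨i, ha⟩)⟩

theorem reduces_subst (R : TRS L V) {w : V → L.Term V} {M s : L.Term V}
    (h : Inst (fun x a => ReflTransGen R.Step a (w x)) M s) :
    ReflTransGen R.Step s (M.subst w) := by
  induction h with
  | var x s h => exact h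
  | func f Ms ts _ ih => exact R.reduces_func f ih

end Inst

namespace SortAttachment

variable (A : SortAttachment L V S)

/-! ### Caps, aliens and stability -/

/-- The result sort of the root symbol; variables are not assigned a root sort. -/
def rootSort : L.Term V → Option S
  | .var _ => none
  | .func f _ => some (A.resSort f)

theorem HasSort.unique {A : SortAttachment L V S} {t : L.Term V} {α β : S}
    (h₁ : A.HasSort t α) (h₂ : A.HasSort t β) : α = β := by
  cases h₁ <;> cases h₂ <;> rfl

theorem HasSort.rootSort_func {A : SortAttachment L V S} {n : ℕ} {f : L.Functions n}
    {ts us : Fin n → L.Term V} {α : S} (h : A.HasSort (.func f ts) α) :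
    A.rootSort (.func f us) = some α := by
  cases h
  rfl

/-- `A.Cap P β s`: the term `s` consists of a cap of sort `β` made of function symbols, whose
holes of sort `γ` are filled with terms `a` of another root sort such that `P γ a`. -/
inductive Cap (P : S → L.Term V → Prop) : S → L.Term V → Prop
  | hole (β : S) (a : L.Term V) (hne : A.rootSort a ≠ some β) (h : P β a) : Cap P β a
  | func {n : ℕ} (f : L.Functions n) (ts : Fin n → L.Term V)
      (h : ∀ i, Cap P (A.argSort f i) (ts i)) : Cap P (A.resSort f) (.func f ts)

/-- `A.Stable R β a`: `a` is confluent and no reduct of `a` has root sort `β`. -/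
def Stable (R : TRS L V) (β : S) (a : L.Term V) : Prop :=
  ConfluentAt R.Step a ∧ ∀ b, ReflTransGen R.Step a b → A.rootSort b ≠ some β

theorem Stable.of_reduct {A : SortAttachment L V S} {R : TRS L V} {β : S} {a b : L.Term V}
    (h : A.Stable R β a) (hab : ReflTransGen R.Step a b) : A.Stable R β b :=
  ⟨h.1.of_reduct hab, fun c hc => h.2 c (hab.trans hc)⟩

theorem Cap.exists_finite {A : SortAttachment L V S} {P : S → L.Term V → Prop} {β : S}
    {s : L.Term V} (h : A.Cap P β s) :
    ∃ F : Set (L.Term V), F.Finite ∧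
      ∀ P' : S → L.Term V → Prop, (∀ γ, ∀ a ∈ F, P γ a → P' γ a) → A.Cap P' β s := by
  induction h with
  | hole β a hne h =>
    exact ⟨{a}, Set.finite_singleton a, fun P' hP => .hole β a hne (hP β a rfl h)⟩
  | func f ts _ ih =>
    choose F hF hP using ih
    exact ⟨⋃ i, F i, Set.finite_iUnion hF, fun P' hP' => .func f _ fun i =>
      hP i P' fun x a ha => hP' x a (Set.mem_iUnion.2 ⟨i, ha⟩)⟩

theorem exists_variables :
    ∃ ι : S → ℕ → V, (∀ β k, A.varSort (ι β k) = β) ∧ ∀ β, Function.Injective (ι β) := by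
  have h (β : S) : Infinite {x : V | A.varSort x = β} := (A.vars_infinite β).to_subtype
  refine ⟨fun β k => (Infinite.natEmbedding {x : V | A.varSort x = β} k : V),
    fun β k => (Infinite.natEmbedding {x : V | A.varSort x = β} k).2, fun β k l hkl => ?_⟩
  exact (Infinite.natEmbedding {x : V | A.varSort x = β}).injective (Subtype.ext hkl)

/-- The family `K` interprets every variable by terms of a different root sort, and distinct
variables of a common sort by disjoint sets. -/
structure Separated (K : V → L.Term V → Prop) : Prop where
  rootSort_ne : ∀ x a, K x a → A.rootSort a ≠ some (A.varSort x)
  eq_of_common : ∀ x y a, K x a → K y a → A.varSort x = A.varSort y → x = y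

/-! ### Simulation by many-sorted terms -/

namespace Separated

variable {A} {K : V → L.Term V → Prop} (hK : A.Separated K)
include hK

/-- The root sort of `s` decides whether a variable or a symbol of `M` stands at the root, and
disjointness decides which variable. Hence equal subterms in slots of equal sort have equal names,
as non-linear patterns require. -/
theorem inst_unique {M M' s : L.Term V} {α : S} (h : Inst K M s) (h' : Inst K M' s)
    (hM : A.HasSort M α) (hM' : A.HasSort M' α) : M = M' := by
  induction h generalizing M' α with
  | var x s h =>
    cases hM
    cases h' with
    | var y _ h' =>
      rw [hK.eq_of_common x y s h h' (hM'.unique (.var y))]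
    | func f Ms ts h' =>
      exfalso
      apply hK.rootSort_ne x _ h
      exact hM'.rootSort_func
  | func f Ms ts h ih =>
    cases h' with
    | var y _ h' =>
      exfalso
      apply hK.rootSort_ne y _ h'
      rw [← hM'.unique (.var y)]
      exact hM.rootSort_func
    | func _ Ms' _ h' =>
      cases hM with
      | func _ _ hs =>
      cases hM' with
      | func _ _ hs' =>
      congr 1
      funext i
      exact ih i (h' i) (hs i) (hs' i)

open Classical in
/-- A sorted pattern matching an instance of a sorted term matches the sorted term itself. -/
theorem exists_matcher (σ : V → L.Term V) :
    ∃ τ : V → L.Term V, ∀ (p M : L.Term V) (α : S), A.HasSort p α → A.HasSort M α →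
      Inst K M (p.subst σ) → M = p.subst τ ∧ ∀ y ∈ p.varFinset, Inst K (τ y) (σ y) := by
  -- By uniqueness one `τ` serves all patterns; the default `.var y` is never used at a variable of
  -- a matched pattern.
  let τ : V → L.Term V := fun y =>
    if h : ∃ M, A.HasSort M (A.varSort y) ∧ Inst K M (σ y) then h.choose else .var y
  have hτ (y : V) (M : L.Term V) (hs : A.HasSort M (A.varSort y)) (hM : Inst K M (σ y)) :
      M = τ y ∧ Inst K (τ y) (σ y) := by
    have h : ∃ M, A.HasSort M (A.varSort y) ∧ Inst K M (σ y) := ⟨M, hs, hM⟩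
    have e : τ y = h.choose := dif_pos h
    rw [e]
    exact ⟨hK.inst_unique hM h.choose_spec.2 hs h.choose_spec.1, h.choose_spec.2⟩
  refine ⟨τ, fun p M α hp => ?_⟩
  induction hp generalizing M with
  | var y =>
    intro hM h
    obtain ⟨h₁, h₂⟩ := hτ y M hM h
    refine ⟨h₁, fun z hz => ?_⟩
    obtain rfl : z = y := by simpa [Term.varFinset] using hz
    exact h₂
  | func f ps hps ih =>
    intro hM h
    cases h with
    | var x _ h =>
      exfalso
      apply hK.rootSort_ne x _ h
      rw [← hM.unique (.var x)]
      rfl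
    | func _ Ms _ h =>
      cases hM with
      | func _ _ hs =>
      have := fun i => ih i (Ms i) (hs i) (h i)
      refine ⟨congrArg (Term.func f) (funext fun i => (this i).1), fun y hy => ?_⟩
      simp only [Term.varFinset, Finset.mem_biUnion] at hy
      obtain ⟨i, _, hi⟩ := hy
      exact (this i).2 y hi

/-- A rewrite step from an instance of a sorted term is simulated by at most one step from the
sorted term. -/
theorem simulate_step {R : TRS L V} (hR : R.Compatible A)
    (hstep : ∀ x a b, K x a → R.Step a b → K x b) {M s t : L.Term V} {α : S}
    (hM : A.HasSort M α) (hs : Inst K M s) (hst : R.Step s t) :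
    ∃ N, Inst K N t ∧ ReflGen R.Step M N := by
  induction hst generalizing M α with
  | root ℓ r h σ =>
    obtain ⟨β, hℓ, hr⟩ := hR ℓ r h
    by_cases hαβ : α = β
    · subst hαβ
      obtain ⟨τ, hτ⟩ := hK.exists_matcher σ
      obtain ⟨rfl, hy⟩ := hτ ℓ M α hℓ hM hs
      exact ⟨r.subst τ, .subst r τ σ fun y hyr => hy y (R.vars_subset ℓ r h hyr),
        .single (.root ℓ r h τ)⟩
    -- The redex has root sort `β ≠ α`, so it cannot be at a cap symbol: `M` is a variable and the
    -- step is inside an alien.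
    · generalize hu : ℓ.subst σ = u at hs
      cases hs with
      | var x _ ha =>
        exact ⟨.var x, .var x _ (hstep x _ _ ha (hu ▸ .root ℓ r h σ)), .refl⟩
      | func g Ms ts hi =>
        cases ℓ with
        | var x => exact absurd rfl (R.lhs_not_var _ _ h x)
        | func f ps =>
          refine absurd (Option.some.inj ?_) hαβ
          rw [← hM.rootSort_func (us := ts), ← hu]
          exact hℓ.rootSort_func
  | arg f ts i t hst ih =>
    cases hs with
    | var x _ ha => exact ⟨.var x, .var x _ (hstep x _ _ ha (.arg f ts i t hst)), .refl⟩
    | func _ Ms _ hi =>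
      cases hM with
      | func _ _ hMs =>
      obtain ⟨N, hN, hMN⟩ := ih (hMs i) (hi i)
      refine ⟨.func f (Function.update Ms i N), .func f _ _ fun j => ?_, ?_⟩
      · by_cases hj : j = i
        · subst hj; simpa using hN
        · simpa [hj] using hi j
      · cases hMN with
        | refl => rw [Function.update_eq_self]
        | single h => exact .single (.arg f Ms i N h)

theorem simulate {R : TRS L V} (hR : R.Compatible A)
    (hclosed : ∀ s ∈ A.sortedTerms, ∀ t, R.Step s t → t ∈ A.sortedTerms)
    (hstep : ∀ x a b, K x a → R.Step a b → K x b) {M s t : L.Term V}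
    (hM : M ∈ A.sortedTerms) (hs : Inst K M s) (hst : ReflTransGen R.Step s t) :
    ∃ N ∈ A.sortedTerms, Inst K N t ∧
      ReflTransGen (fun s t => s ∈ A.sortedTerms ∧ t ∈ A.sortedTerms ∧ R.Step s t) M N := by
  induction hst with
  | refl => exact ⟨M, hM, hs, .refl⟩
  | tail _ hbc ih =>
    obtain ⟨N, hN, hi, hMN⟩ := ih
    obtain ⟨α, hα⟩ := id hN
    obtain ⟨N', hi', hNN'⟩ := hK.simulate_step hR hstep hα hi hbc
    cases hNN' with
    | refl => exact ⟨N, hN, hi', hMN⟩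
    | single h =>
      have hN' := hclosed N hN N' h
      exact ⟨N', hN', hi', hMN.tail ⟨hN, hN', h⟩⟩

/-- If sorted terms are confluent and the members of each `K x` are confluent and pairwise
joinable, then instances of sorted terms are confluent. -/
theorem confluentAt_of_inst {R : TRS L V} (hR : R.Compatible A)
    (hconf : ConfluentOn R.Step A.sortedTerms)
    (hstep : ∀ x a b, K x a → R.Step a b → K x b)
    (hcon : ∀ x a, K x a → ConfluentAt R.Step a)
    (hjoin : ∀ x a b, K x a → K x b → Joinable R.Step a b)
    {M s : L.Term V} (hM : M ∈ A.sortedTerms) (hs : Inst K M s) : ConfluentAt R.Step s := by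
  intro t₁ t₂ h₁ h₂
  obtain ⟨N₁, -, hi₁, hN₁⟩ := hK.simulate hR hconf.1 hstep hM hs h₁
  obtain ⟨N₂, -, hi₂, hN₂⟩ := hK.simulate hR hconf.1 hstep hM hs h₂
  obtain ⟨N, hN₁, hN₂⟩ := hconf.2 M N₁ N₂ hN₁ hN₂
  obtain ⟨F₁, hF₁, hF₁'⟩ := hi₁.exists_finite
  obtain ⟨F₂, hF₂, hF₂'⟩ := hi₂.exists_finite
  -- One reduct serves all fillings of `x` on both sides, turning both ends into substitution
  -- instances.
  have hw (x : V) : ∃ w, ∀ a ∈ {a ∈ F₁ ∪ F₂ | K x a}, ReflTransGen R.Step a w :=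
    have : Nonempty (L.Term V) := ⟨s⟩
    exists_common_reduct ((hF₁.union hF₂).subset (Set.sep_subset _ _))
      (fun a ha => hcon x a ha.2) (fun a ha b hb => hjoin x a b ha.2 hb.2)
  choose w hw using hw
  have h₁ := (hF₁' _ fun x a ha hx => hw x a ⟨.inl ha, hx⟩).reduces_subst
  have h₂ := (hF₂' _ fun x a ha hx => hw x a ⟨.inr ha, hx⟩).reduces_subst
  refine ⟨N.subst w, h₁.trans ?_, h₂.trans ?_⟩
  · exact hN₁.lift (fun t => t.subst w) fun _ _ h => h.2.2.subst w
  · exact hN₂.lift (fun t => t.subst w) fun _ _ h => h.2.2.subst w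

end Separated

/-- Terms all of whose aliens are stable are confluent. -/
theorem Cap.confluentAt {A : SortAttachment L V S} {R : TRS L V} (hR : R.Compatible A)
    (hconf : ConfluentOn R.Step A.sortedTerms) {β : S} {s : L.Term V}
    (hs : A.Cap (A.Stable R) β s) : ConfluentAt R.Step s := by
  obtain ⟨F, hF, hF'⟩ := hs.exists_finite
  obtain ⟨e, he⟩ := exists_class_index (r := R.Step) hF.countable
  obtain ⟨ι, hι, hinj⟩ := A.exists_variables
  -- Only the representative `a` lies in `F`; `b` ranges over its whole class of stable terms, which
  -- makes `K` closed under reduction.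
  let K : V → L.Term V → Prop := fun x b => A.Stable R (A.varSort x) b ∧
    ∃ a ∈ F, ConfluentAt R.Step a ∧ Joinable R.Step a b ∧ ι (A.varSort x) (e a) = x
  have hK : A.Separated K := by
    refine ⟨fun x a h => h.1.2 a .refl, ?_⟩
    rintro x y b ⟨hb, a, haF, ha, hab, hx⟩ ⟨-, a', haF', ha', hab', hy⟩ hxy
    rw [← hx, ← hy, hxy, (he a haF a' haF' ha ha').2 (hb.1.joinable_trans hab hab'.symm)]
  have hinst : ∃ M, A.HasSort M β ∧ Inst K M s := by
    have := hF' (fun γ a => A.Stable R γ a ∧ a ∈ F) fun γ a ha h => ⟨h, ha⟩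
    clear hs hF'
    induction this with
    | hole γ a _ h =>
      refine ⟨.var (ι γ (e a)), ?_, .var _ _ ?_⟩
      · simpa only [hι] using HasSort.var (A := A) (ι γ (e a))
      · simp only [K, hι]
        exact ⟨h.1, a, h.2, h.1.1, .refl a, rfl⟩
    | func f ts _ ih =>
      choose Ms h₁ h₂ using ih
      exact ⟨.func f Ms, .func f Ms h₁, .func f Ms ts h₂⟩
  obtain ⟨M, hM, hi⟩ := hinst
  refine hK.confluentAt_of_inst hR hconf ?_ (fun x a h => h.1.1) ?_ ⟨β, hM⟩ hi
  · rintro x b c ⟨hb, a, haF, ha, hab, hx⟩ hbc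
    exact ⟨hb.of_reduct (.single hbc), a, haF, ha,
      hb.1.joinable_trans hab ⟨c, .single hbc, .refl⟩, hx⟩
  · rintro x b c ⟨hb, a, haF, ha, hab, hx⟩ ⟨hc, a', haF', ha', hac, hx'⟩
    have : Joinable R.Step a a' :=
      (he a haF a' haF' ha ha').1 (hinj (A.varSort x) (hx.trans hx'.symm))
    exact ha.joinable_trans hab.symm (ha'.joinable_trans this hac)

/-! ### Rank and its decrease under fusion -/

open Classical in
/-- The number of nested layers of a term, variables being aliens of rank `0`. -/
noncomputable def rank : L.Term V → ℕ
  | .var _ => 0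
  | .func f ts => Finset.univ.sup fun i =>
      if A.rootSort (ts i) = some (A.argSort f i) then rank (ts i) else rank (ts i) + 1

open Classical in
/-- The contribution of a term to the rank of a surrounding cap that expects sort `β`. -/
noncomputable def slotRank (β : S) (t : L.Term V) : ℕ :=
  if A.rootSort t = some β then A.rank t else A.rank t + 1

theorem slotRank_eq {β : S} {t : L.Term V} (h : A.rootSort t = some β) :
    A.slotRank β t = A.rank t := if_pos h

theorem slotRank_ne {β : S} {t : L.Term V} (h : A.rootSort t ≠ some β) :
    A.slotRank β t = A.rank t + 1 := if_neg h

theorem rank_le_slotRank (β : S) (t : L.Term V) : A.rank t ≤ A.slotRank β t := by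
  unfold slotRank; split <;> omega

theorem slotRank_le (β : S) (t : L.Term V) : A.slotRank β t ≤ A.rank t + 1 := by
  unfold slotRank; split <;> omega

theorem rank_func_le_iff {n : ℕ} (f : L.Functions n) (ts : Fin n → L.Term V) (k : ℕ) :
    A.rank (.func f ts) ≤ k ↔ ∀ i, A.slotRank (A.argSort f i) (ts i) ≤ k := by
  simp only [rank, Finset.sup_le_iff, Finset.mem_univ, true_imp_iff, slotRank]

theorem slotRank_func_le_iff {n : ℕ} (f : L.Functions n) (ts : Fin n → L.Term V) (k : ℕ) :
    A.slotRank (A.resSort f) (.func f ts) ≤ k ↔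
      ∀ i, A.slotRank (A.argSort f i) (ts i) ≤ k := by
  rw [slotRank_eq A rfl, rank_func_le_iff]

open Classical in
theorem slotRank_subst_le_iff {p : L.Term V} {β : S} (hp : A.HasSort p β) (σ : V → L.Term V)
    (k : ℕ) : A.slotRank β (p.subst σ) ≤ k ↔
      ∀ y ∈ p.varFinset, A.slotRank (A.varSort y) (σ y) ≤ k := by
  induction hp with
  | var x => simp [Term.varFinset, Term.subst]
  | func f ts _ ih =>
    simp only [Term.subst, slotRank_func_le_iff, ih, Term.varFinset, Finset.mem_biUnion,
      Finset.mem_univ, true_and]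
    exact ⟨fun h y ⟨i, hy⟩ => h i y hy, fun h i y hy => h y ⟨i, hy⟩⟩

variable {A} {R : TRS L V}

/-- The slot of the root's own sort is decisive: in any other slot the extra layer of `s` absorbs
whatever `t` may gain. -/
theorem slotRank_step (hR : R.Compatible A) {s t : L.Term V} (h : R.Step s t) (β : S) :
    A.slotRank β t ≤ A.slotRank β s := by
  have lift {s t : L.Term V} (α : S) (hs : A.rootSort s = some α)
      (h : A.slotRank α t ≤ A.slotRank α s) (β : S) : A.slotRank β t ≤ A.slotRank β s := by
    by_cases hβ : A.rootSort s = some β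
    · obtain rfl : α = β := Option.some.inj (hs.symm.trans hβ)
      exact h
    · rw [A.slotRank_ne hβ]
      rw [A.slotRank_eq hs] at h
      have := A.rank_le_slotRank α t
      have := A.slotRank_le β t
      omega
  induction h generalizing β with
  | root ℓ r h σ =>
    obtain ⟨α, hℓ, hr⟩ := hR ℓ r h
    refine lift α ?_ ?_ β
    · cases ℓ with
      | var x => exact absurd rfl (R.lhs_not_var _ _ h x)
      | func f ts => exact hℓ.rootSort_func
    · rw [A.slotRank_subst_le_iff hr]
      exact fun y hy =>
        (A.slotRank_subst_le_iff hℓ σ _).1 le_rfl y (R.vars_subset ℓ r h hy)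
  | arg f ts i t _ ih =>
    refine lift (A.resSort f) rfl ?_ β
    rw [slotRank_func_le_iff]
    intro j
    have hj := (A.slotRank_func_le_iff f ts _).1 le_rfl j
    by_cases hji : j = i
    · subst hji
      simpa using (ih _).trans hj
    · simpa [hji] using hj

theorem slotRank_reduces (hR : R.Compatible A) {s t : L.Term V}
    (h : ReflTransGen R.Step s t) (β : S) : A.slotRank β t ≤ A.slotRank β s := by
  induction h with
  | refl => exact le_rfl
  | tail _ h ih => exact (slotRank_step hR h β).trans ih

/-- If terms of smaller rank are confluent, every term reduces to one with stable aliens. -/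
theorem exists_reduct_cap (hR : R.Compatible A) {n : ℕ}
    (hn : ∀ a : L.Term V, A.rank a < n → ConfluentAt R.Step a) (a : L.Term V) (β : S)
    (ha : A.slotRank β a ≤ n) :
    ∃ b, ReflTransGen R.Step a b ∧ A.Cap (A.Stable R) β b := by
  induction hm : A.slotRank β a using Nat.strong_induction_on generalizing a β with
  | _ m ihm =>
  -- The inequality passes to arguments, allowing a structural induction with the same bound `m`.
  replace hm := hm.le
  have alien {a : L.Term V} {β : S} (ha : A.slotRank β a ≤ n) (hm : A.slotRank β a ≤ m)
      (hne : A.rootSort a ≠ some β) :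
      ∃ b, ReflTransGen R.Step a b ∧ A.Cap (A.Stable R) β b := by
    -- Fusing with the surrounding cap removes a layer, so `ihm` applies; an alien that can never
    -- fuse is already stable.
    by_cases h : ∃ a', ReflTransGen R.Step a a' ∧ A.rootSort a' = some β
    · obtain ⟨a', haa', ha'⟩ := h
      have hlt : A.slotRank β a' < A.slotRank β a := by
        have hle := slotRank_reduces hR haa' β
        have hrank : A.rank a' ≤ A.rank a := by
          cases a with
          | var x =>
            rcases haa'.cases_head with h | ⟨c, h, -⟩
            · exact absurd (h ▸ ha') hne
            · exact absurd h (R.not_step_var x c)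
          | func f ts =>
            have := slotRank_reduces hR haa' (A.resSort f)
            rw [A.slotRank_eq (t := .func f ts) rfl] at this
            exact (A.rank_le_slotRank _ _).trans this
        rw [A.slotRank_eq ha', A.slotRank_ne hne]
        omega
      obtain ⟨b, hb, hb'⟩ := ihm _ (hlt.trans_le hm) a' β (hlt.le.trans ha) rfl
      exact ⟨b, haa'.trans hb, hb'⟩
    · rw [A.slotRank_ne hne] at ha
      exact ⟨a, .refl, .hole β a hne ⟨hn a ha, fun b hb hb' => h ⟨b, hb, hb'⟩⟩⟩
  induction a generalizing β with
  | var x => exact alien ha hm (by simp [rootSort])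
  | func f ts ih =>
    by_cases hβ : A.resSort f = β
    · subst hβ
      rw [slotRank_func_le_iff] at ha hm
      choose us h₁ h₂ using fun i => ih i _ (ha i) (hm i)
      exact ⟨.func f us, R.reduces_func f h₁, .func f us h₂⟩
    · exact alien ha hm (by simpa [rootSort] using hβ)

/-! ### Uniform stabilization of aliens -/

open Classical in
/-- Replace every alien `a` of the `β`-sorted cap of a term, in a slot of sort `γ`, by
`b γ a`. -/
noncomputable def mapAliens (A : SortAttachment L V S) (b : S → L.Term V → L.Term V) :
    S → L.Term V → L.Term V
  | β, .var x => b β (.var x)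
  | β, .func f ts =>
    if A.resSort f = β then .func f fun i => mapAliens A b (A.argSort f i) (ts i)
    else b β (.func f ts)

section MapAliens

variable {b : S → L.Term V → L.Term V}

theorem mapAliens_func {n : ℕ} (f : L.Functions n) (ts : Fin n → L.Term V) :
    A.mapAliens b (A.resSort f) (.func f ts) =
      .func f fun i => A.mapAliens b (A.argSort f i) (ts i) := by
  rw [mapAliens, if_pos rfl]

theorem mapAliens_of_ne {β : S} {s : L.Term V} (h : A.rootSort s ≠ some β) :
    A.mapAliens b β s = b β s := by
  cases s with
  | var x => rw [mapAliens]
  | func f ts => rw [mapAliens, if_neg]; simpa [rootSort] using h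

/-- Equal aliens in slots of equal sort get equal replacements, so a redex in the cap remains a
redex. -/
theorem mapAliens_subst {p : L.Term V} {β : S} (hp : A.HasSort p β) (σ : V → L.Term V) :
    A.mapAliens b β (p.subst σ) = p.subst fun y => A.mapAliens b (A.varSort y) (σ y) := by
  induction hp with
  | var x => rfl
  | func f ts _ ih =>
    simp only [Term.subst, mapAliens_func]
    congr 1
    funext i
    exact ih i

theorem reduces_mapAliens (hb : ∀ γ a, ReflTransGen R.Step a (b γ a)) (β : S)
    (s : L.Term V) : ReflTransGen R.Step s (A.mapAliens b β s) := by
  induction s generalizing β with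
  | var x => rw [mapAliens]; exact hb _ _
  | func f ts ih =>
    by_cases hβ : A.resSort f = β
    · subst hβ
      rw [mapAliens_func]
      exact R.reduces_func f fun i => ih i _
    · rw [mapAliens_of_ne (by simpa [rootSort] using hβ)]
      exact hb _ _

theorem cap_mapAliens {P : S → L.Term V → Prop} {n : ℕ}
    (hb : ∀ γ a, A.slotRank γ a ≤ n → A.Cap P γ (b γ a)) (β : S) (s : L.Term V)
    (hs : A.slotRank β s ≤ n) : A.Cap P β (A.mapAliens b β s) := by
  induction s generalizing β with
  | var x => rw [mapAliens]; exact hb _ _ hs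
  | func f ts ih =>
    by_cases hβ : A.resSort f = β
    · subst hβ
      rw [mapAliens_func]
      exact .func f _ fun i => ih i _ ((A.slotRank_func_le_iff f ts n).1 hs i)
    · rw [mapAliens_of_ne (by simpa [rootSort] using hβ)]
      exact hb _ _ hs

/-- A cap step survives the replacement. If `s` is an alien, both images are reducts of `s`, even if
`t` has fused, and `s` is confluent. -/
theorem joinable_mapAliens_of_step (hR : R.Compatible A) {n : ℕ}
    (hn : ∀ a : L.Term V, A.rank a < n → ConfluentAt R.Step a)
    (hb : ∀ γ a, ReflTransGen R.Step a (b γ a)) {s t : L.Term V} (h : R.Step s t) (β : S)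
    (hs : A.slotRank β s ≤ n) :
    Joinable R.Step (A.mapAliens b β s) (A.mapAliens b β t) := by
  have alien {s t : L.Term V} (h : R.Step s t) {β : S} (hs : A.slotRank β s ≤ n)
      (hne : A.rootSort s ≠ some β) :
      Joinable R.Step (A.mapAliens b β s) (A.mapAliens b β t) := by
    rw [A.slotRank_ne hne] at hs
    exact hn s hs _ _ (reduces_mapAliens hb β s) (.head h (reduces_mapAliens hb β t))
  induction h generalizing β with
  | root ℓ r h σ =>
    by_cases hβ : A.rootSort (ℓ.subst σ) = some β
    · obtain ⟨α, hℓ, hr⟩ := hR ℓ r h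
      obtain rfl : α = β := by
        cases ℓ with
        | var x => exact absurd rfl (R.lhs_not_var _ _ h x)
        | func f ts => exact Option.some.inj (hℓ.rootSort_func.symm.trans hβ)
      rw [mapAliens_subst hℓ, mapAliens_subst hr]
      exact ⟨_, .single (.root ℓ r h _), .refl⟩
    · exact alien (.root ℓ r h σ) hs hβ
  | arg f ts i t h ih =>
    by_cases hβ : A.resSort f = β
    · subst hβ
      rw [mapAliens_func, mapAliens_func]
      refine R.joinable_func f fun j => ?_
      by_cases hj : j = i
      · subst hj
        simpa using ih _ ((A.slotRank_func_le_iff f ts n).1 hs j)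
      · simpa [hj] using Joinable.refl _
    · exact alien (.arg f ts i t h) hs (by simpa [rootSort] using hβ)

end MapAliens

theorem confluentAt_of_rank (hR : R.Compatible A)
    (hconf : ConfluentOn R.Step A.sortedTerms) (n : ℕ)
    (hn : ∀ a : L.Term V, A.rank a < n → ConfluentAt R.Step a) (β : S) (s : L.Term V)
    (hs : A.slotRank β s ≤ n) : ConfluentAt R.Step s := by
  have hex (γ : S) (a : L.Term V) : ∃ c, ReflTransGen R.Step a c ∧
      (A.slotRank γ a ≤ n → A.Cap (A.Stable R) γ c) := by
    by_cases ha : A.slotRank γ a ≤ n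
    · obtain ⟨c, h₁, h₂⟩ := exists_reduct_cap hR hn a γ ha
      exact ⟨c, h₁, fun _ => h₂⟩
    · exact ⟨a, .refl, fun h => absurd h ha⟩
  choose b hb hcap using hex
  have conf {t : L.Term V} (ht : A.slotRank β t ≤ n) :
      ConfluentAt R.Step (A.mapAliens b β t) :=
    (cap_mapAliens hcap β t ht).confluentAt hR hconf
  have join {t : L.Term V} (h : ReflTransGen R.Step s t) :
      Joinable R.Step (A.mapAliens b β s) (A.mapAliens b β t) := by
    induction h with
    | refl => exact .refl _
    | tail h h' ih =>
      have hle := (slotRank_reduces hR h β).trans hs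
      exact (conf hle).joinable_trans ih (joinable_mapAliens_of_step hR hn hb h' β hle)
  intro t₁ t₂ h₁ h₂
  obtain ⟨v, hv₁, hv₂⟩ := (conf hs).joinable_trans (join h₁).symm (join h₂)
  exact ⟨v, (reduces_mapAliens hb β t₁).trans hv₁, (reduces_mapAliens hb β t₂).trans hv₂⟩

end SortAttachment
end TermRewriting

theorem mainTheorem10 {L : FirstOrder.Language.{u, v}} {V : Type w} [Countable V] [Infinite V]
    {S : Type z} (A : TermRewriting.SortAttachment L V S) (R : TermRewriting.TRS L V)
    (hR : R.Compatible A)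
    (hconf : TermRewriting.ConfluentOn R.Step A.sortedTerms) :
    TermRewriting.Confluent R.Step := by
  suffices h : ∀ n, ∀ s : L.Term V, A.rank s ≤ n → TermRewriting.ConfluentAt R.Step s from
    fun s t u => h _ s le_rfl t u
  intro n
  induction n using Nat.strong_induction_on with
  | _ n ih =>
  intro s hs
  have hn (a : L.Term V) (ha : A.rank a < n) : TermRewriting.ConfluentAt R.Step a :=
    ih _ ha a le_rfl
  -- A variable is an alien in every slot, so its slot rank exceeds its rank; it is handled as a
  -- normal form.
  cases s with
  | var x =>
    intro t u ht hu
    have h {t : L.Term V} (ht : Relation.ReflTransGen R.Step (.var x) t) : t = .var x := by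
      rcases ht.cases_head with h | ⟨c, h, -⟩
      · exact h.symm
      · exact absurd h (R.not_step_var x c)
    rw [h ht, h hu]
    exact .refl _
  | func f ts =>
    exact TermRewriting.SortAttachment.confluentAt_of_rank hR hconf n hn (A.resSort f) _
      (by rwa [A.slotRank_eq rfl])
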